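/- Let $\psi$ be any nonnegative real-valued function on the positive integers. For each integer $n\ge 1$ let $$\mathcal{E}_n:=\bigcup_{\substack{1\le a\le n\\ \gcd(a,n)=1}}\left(\frac{a-\psi(n)}{n},\frac{a+\psi(n)}{n}\right)\subseteq\mathbb{R}/\mathbb{Z}$$ (each open interval being projected from $\mathbb{R}$ to $\mathbb{R}/\mathbb{Z}$), and let $W(\psi):=\bigcap_{m=1}^\infty\bigcup_{n\ge m}\mathcal{E}_n$ be the set of points of $\mathbb{R}/\mathbb{Z}$ lying in infinitely many of the sets $\mathcal{E}_n$. Let $\lambda$ denote Lebesgue measure on $\mathbb{R}/\mathbb{Z}$ (so $\lambda(\mathbb{R}/\mathbb{Z})=1$) and $\varphi$ the Euler phi function. If there exists an $\epsilon>0$ such that $$\sum_{n=1}^{\infty}\left(\frac{\psi(n)}{n}\right)^{1+\epsilon}\varphi(n)=\infty,$$ then $\lambda(W(\psi))=1$. -/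

import Mathlib

namespace DuffinSchaeffer

/-- The set `𝓔ₙ ⊆ ℝ/ℤ`: the union, over the integers `1 ≤ a ≤ n` coprime to `n`, of the images
in `ℝ/ℤ` of the open intervals `((a - ψ(n))/n, (a + ψ(n))/n)`. -/
def approxSet (ψ : ℕ → ℝ) (n : ℕ) : Set UnitAddCircle :=
  ⋃ a : ℕ, ⋃ _ : 1 ≤ a ∧ a ≤ n ∧ Nat.Coprime a n,
    (fun x : ℝ => (x : UnitAddCircle)) '' Set.Ioo (((a : ℝ) - ψ n) / n) (((a : ℝ) + ψ n) / n)

/-- The limsup set `W(ψ) = ⋂_{m ≥ 1} ⋃_{n ≥ m} 𝓔ₙ` of points of `ℝ/ℤ` lying in infinitely many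
of the sets `𝓔ₙ`, `n ≥ 1`. -/
def W (ψ : ℕ → ℝ) : Set UnitAddCircle :=
  ⋂ m : ℕ, ⋂ _ : 1 ≤ m, ⋃ n : ℕ, ⋃ _ : m ≤ n, approxSet ψ n

end DuffinSchaeffer

/-! Replace `ψ n` by `min (ψ n) (√n)` and set `ρ n = min (ψ n) (√n) / n`, which tends to 0. The
extra power `ε` in the divergence forces, for some `η > 0` and infinitely many `k`, the dyadic sum
`M` of `φ(n) ρ(n)` over `2^k ≤ n < 2^(k+1)` to be at least `2^(ηk)`
(`exists_frequently_le_sum_truncatedRadius`). In such a block a second moment argument bounds the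
measure of the union of the approximation sets below by a constant independent of `k`. Hence the
limsup set has positive measure, and Gallagher's zero-one law makes it full.

The second moment needs overlaps of size `O(M²)` in total. Exact coprimality is too rigid for this,
so reduced fractions are enlarged to fractions sieved only by primes up to `y ≈ ηk/4`. An integer
below `2^(k+1)` has at most `k` prime factors, so those above `y` change the count by a bounded
factor only (`sieved_card_le`). With `P = primorial y`, the sieved set of denominator `n` is
periodic under `P` times the `n`-torsion, and averaging over common periods gives quasi-independence
unless both radii are tiny (`lintegral_ballCount_mul_le`). The remaining pairs cost a multiple of `P
gcd(m, n) ρ(n)` (`lintegral_overlap_le`). The divisor bound and `P ≤ 4^y` keep that cost below `8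
M²`, thanks to the room given by `M ≥ 2^(ηk)`. -/

namespace DuffinSchaeffer

open Finset

/-! ### Arithmetic: sieving by small primes, the divisor bound, gcd sums. -/

theorem card_filter_coprime_range_mul (q e : ℕ) :
    #{a ∈ range (q * e) | a.Coprime e} = q * e.totient := by
  induction q with
  | zero => simp
  | succ q ih =>
    have h1 : range ((q + 1) * e) = range (q * e) ∪ Ico (q * e) (q * e + e) := by
      rw [range_eq_Ico, range_eq_Ico, Ico_union_Ico_eq_Ico (Nat.zero_le _) (Nat.le_add_right _ _),
        add_one_mul]
    have h2 : #{a ∈ Ico (q * e) (q * e + e) | a.Coprime e} = e.totient := by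
      rw [← Nat.filter_coprime_Ico_eq_totient e (q * e)]
      simp_rw [Nat.coprime_comm]
    rw [h1, filter_union, card_union_of_disjoint, ih, h2, add_one_mul]
    refine disjoint_filter_filter ?_
    rw [range_eq_Ico]
    exact Ico_disjoint_Ico_consecutive _ _ _

theorem card_primeFactors_le_of_lt_two_pow {n k : ℕ} (hn : 0 < n) (h : n < 2 ^ (k + 1)) :
    #n.primeFactors ≤ k := by
  have h1 : 2 ^ #n.primeFactors ≤ ∏ p ∈ n.primeFactors, p :=
    pow_card_le_prod _ _ _ fun p hp => (Nat.prime_of_mem_primeFactors hp).two_le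
  have h2 : ∏ p ∈ n.primeFactors, p ≤ n := Nat.le_of_dvd hn (Nat.prod_primeFactors_dvd n)
  have := (Nat.pow_lt_pow_iff_right (le_refl 2)).1 (h1.trans_lt (h2.trans_lt h))
  omega

/-- For `z ≥ 2`, `1 - 1/z` is the inverse of `1 + 1/(z-1)`, hence at least `exp(-1/(z-1)) ≥
exp(-2/z)`. -/
theorem exp_neg_le_one_sub_inv_pow {z : ℝ} (hz : 2 ≤ z) {k : ℕ} {κ : ℝ} (hk : k ≤ κ * z) :
    Real.exp (-(2 * κ)) ≤ (1 - 1 / z) ^ k := by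
  have h1 : Real.exp (-(2 / z)) ≤ 1 - 1 / z := by
    have h := Real.add_one_le_exp (1 / (z - 1))
    have h3 : Real.exp (-(1 / (z - 1))) ≤ 1 - 1 / z := by
      rw [Real.exp_neg]
      have : (1 - 1 / z) = (1 / (z - 1) + 1)⁻¹ := by
        have h1 : z - 1 ≠ 0 := by linarith
        have h2 : z ≠ 0 := by linarith
        rw [show 1 / (z - 1) + 1 = z / (z - 1) by rw [div_add_one h1]; ring_nf, inv_div, sub_div, div_self h2]
      rw [this]
      have : 0 < z - 1 := by linarith
      exact inv_anti₀ (by positivity) h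
    refine le_trans (Real.exp_le_exp.2 ?_) h3
    rw [neg_le_neg_iff, div_le_div_iff₀ (by linarith) (by linarith)]
    linarith
  calc Real.exp (-(2 * κ)) ≤ Real.exp (k * -(2 / z)) := by
        apply Real.exp_le_exp.2
        have : (k : ℝ) / z ≤ κ := (div_le_iff₀ (by linarith)).2 hk
        have h : (k : ℝ) * -(2 / z) = -(2 * (k / z)) := by ring
        rw [h]; linarith
    _ = Real.exp (-(2 / z)) ^ k := Real.exp_nat_mul _ _
    _ ≤ _ := pow_le_pow_left₀ (Real.exp_pos _).le h1 k

theorem totient_eq_mul_prod_real (n : ℕ) :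
    (n.totient : ℝ) = n * ∏ p ∈ n.primeFactors, (1 - 1 / (p : ℝ)) := by
  have h := Nat.totient_eq_mul_prod_factors n
  have h2 : ((n.totient : ℚ) : ℝ) = ((n * ∏ p ∈ n.primeFactors, (1 - (p : ℚ)⁻¹) : ℚ) : ℝ) := by
    rw [h]
  push_cast at h2
  simpa [one_div] using h2

/-- Integers below `2 ^ (k + 1)` have few prime factors exceeding `y`, hence sieving only by the
primes up to `y` counts at most a constant times the totient. -/
theorem sieved_card_le {n k y : ℕ} {κ : ℝ} (hn : 0 < n) (h : n < 2 ^ (k + 1)) (hy : 1 ≤ y)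
    (hk : (k : ℝ) ≤ κ * (y + 1)) :
    ((n / n.gcd (primorial y) * (n.gcd (primorial y)).totient : ℕ) : ℝ)
      ≤ Real.exp (2 * κ) * n.totient := by
  set e := n.gcd (primorial y) with he
  have he0 : 0 < e := Nat.gcd_pos_of_pos_left _ hn
  have hen : e ∣ n := Nat.gcd_dvd_left _ _
  have hpf : e.primeFactors = n.primeFactors.filter (· ≤ y) := by
    ext p
    simp only [mem_filter, Nat.mem_primeFactors]
    constructor
    · rintro ⟨hp, hpe, -⟩
      refine ⟨⟨hp, hpe.trans hen, hn.ne'⟩, ?_⟩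
      exact (hp.dvd_primorial_iff).1 (hpe.trans (Nat.gcd_dvd_right _ _))
    · rintro ⟨⟨hp, hpn, -⟩, hpy⟩
      exact ⟨hp, Nat.dvd_gcd hpn (hp.dvd_primorial_iff.2 hpy), he0.ne'⟩
  have h1 : ((n / e * e.totient : ℕ) : ℝ)
      = n * ∏ p ∈ n.primeFactors.filter (· ≤ y), (1 - 1 / (p : ℝ)) := by
    rw [Nat.cast_mul, totient_eq_mul_prod_real e, hpf, ← mul_assoc, ← Nat.cast_mul,
      Nat.div_mul_cancel hen]
  have h2 : (n.totient : ℝ) = ((n / e * e.totient : ℕ) : ℝ) *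
      ∏ p ∈ n.primeFactors.filter (¬ · ≤ y), (1 - 1 / (p : ℝ)) := by
    rw [h1, totient_eq_mul_prod_real n, mul_assoc, prod_filter_mul_prod_filter_not]
  have hz : (2 : ℝ) ≤ (y : ℝ) + 1 := by
    have : (1 : ℝ) ≤ y := by exact_mod_cast hy
    linarith
  have hz0 : 0 ≤ 1 - 1 / ((y : ℝ) + 1) := by
    rw [sub_nonneg, div_le_one (by linarith)]; linarith
  -- At most `k` primes divide `n`, and each one above `y` costs a factor at least `1 - 1/(y+1)`.
  have h3 : (1 - 1 / ((y : ℝ) + 1)) ^ k ≤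
      ∏ p ∈ n.primeFactors.filter (¬ · ≤ y), (1 - 1 / (p : ℝ)) := by
    calc (1 - 1 / ((y : ℝ) + 1)) ^ k
        ≤ (1 - 1 / ((y : ℝ) + 1)) ^ #(n.primeFactors.filter (¬ · ≤ y)) := by
          refine pow_le_pow_of_le_one hz0 ?_ ?_
          · have : 0 ≤ 1 / ((y : ℝ) + 1) := by positivity
            linarith
          · exact (card_filter_le _ _).trans (card_primeFactors_le_of_lt_two_pow hn h)
      _ = ∏ _p ∈ n.primeFactors.filter (¬ · ≤ y), (1 - 1 / ((y : ℝ) + 1)) := by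
          rw [prod_const]
      _ ≤ _ := by
          refine prod_le_prod (fun _ _ => hz0) fun p hp => ?_
          have hp' : y + 1 ≤ p := by
            have := (mem_filter.1 hp).2
            omega
          have : (y : ℝ) + 1 ≤ p := by exact_mod_cast hp'
          have := one_div_le_one_div_of_le (by linarith) this
          linarith
  have h4 := (exp_neg_le_one_sub_inv_pow hz hk).trans h3
  rw [h2]
  set x : ℝ := ((n / e * e.totient : ℕ) : ℝ) with hx
  have hx0 : 0 ≤ x := Nat.cast_nonneg _
  calc x = Real.exp (2 * κ) * (x * Real.exp (-(2 * κ))) := by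
        rw [mul_left_comm, ← Real.exp_add, add_neg_cancel, Real.exp_zero, mul_one]
    _ ≤ _ := by gcongr

/-- Each term of `n = ∑_{d ∣ n} φ(d)` is at most `φ(n)`. This is the only lower bound for the
totient that is needed. -/
theorem le_totient_mul_card_divisors {n : ℕ} (hn : 0 < n) : n ≤ n.totient * #n.divisors := by
  conv_lhs => rw [← Nat.sum_totient n]
  calc ∑ d ∈ n.divisors, d.totient ≤ ∑ _d ∈ n.divisors, n.totient :=
        sum_le_sum fun d hd => Nat.le_of_dvd (Nat.totient_pos.2 hn)
          (Nat.totient_dvd_of_dvd (Nat.dvd_of_mem_divisors hd))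
    _ = _ := by rw [sum_const, smul_eq_mul, mul_comm]

/-- Compare prime by prime: if `p ≥ 2^(1/δ)` then `a + 1 ≤ 2^a ≤ p^(aδ)`. The at most `B` smaller
primes each lose a factor at most `c`. -/
theorem exists_card_divisors_le_rpow {δ : ℝ} (hδ : 0 < δ) :
    ∃ C : ℝ, 0 < C ∧ ∀ n : ℕ, 0 < n → (#n.divisors : ℝ) ≤ C * (n : ℝ) ^ δ := by
  set c : ℝ := max 1 (1 / (δ * Real.log 2)) with hc
  have hc1 : 1 ≤ c := le_max_left _ _
  have hlog : 0 < δ * Real.log 2 := mul_pos hδ (Real.log_pos one_lt_two)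
  obtain ⟨B, hB⟩ := exists_nat_ge ((2 : ℝ) ^ (1 / δ))
  refine ⟨c ^ B, by positivity, fun n hn => ?_⟩
  have key : ∀ p : ℕ, p.Prime → ∀ a : ℕ,
      ((a : ℝ) + 1) ≤ (if p < B then c else 1) * ((p : ℝ) ^ a) ^ δ := by
    intro p hp a
    have hp0 : (0 : ℝ) ≤ p := Nat.cast_nonneg _
    split_ifs with hpB
    · have h1 : (2 : ℝ) ^ (δ * a) ≤ ((p : ℝ) ^ a) ^ δ := by
        rw [← Real.rpow_natCast, ← Real.rpow_mul hp0, mul_comm]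
        exact Real.rpow_le_rpow (by norm_num) (by exact_mod_cast hp.two_le) (by positivity)
      have h2 : 1 + δ * Real.log 2 * a ≤ (2 : ℝ) ^ (δ * a) := by
        rw [Real.rpow_def_of_pos two_pos]
        have := Real.add_one_le_exp (Real.log 2 * (δ * a))
        linarith
      have h3 : (a : ℝ) + 1 ≤ c * (1 + δ * Real.log 2 * a) := by
        have h4 : 1 ≤ c * (δ * Real.log 2) := by
          calc (1 : ℝ) = 1 / (δ * Real.log 2) * (δ * Real.log 2) := by field_simp
            _ ≤ _ := by gcongr; exact le_max_right _ _
        have : (a : ℝ) * 1 ≤ a * (c * (δ * Real.log 2)) := by gcongr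
        linarith
      exact h3.trans (by gcongr; exact h2.trans h1)
    · have h1 : (2 : ℝ) ≤ (p : ℝ) ^ δ := by
        have : (2 : ℝ) ^ (1 / δ) ≤ p := hB.trans (by exact_mod_cast not_lt.1 hpB)
        calc (2 : ℝ) = ((2 : ℝ) ^ (1 / δ)) ^ δ := by
              rw [← Real.rpow_mul two_pos.le, one_div_mul_cancel hδ.ne', Real.rpow_one]
          _ ≤ _ := Real.rpow_le_rpow (by positivity) this hδ.le
      have h2 : ((p : ℝ) ^ a) ^ δ = ((p : ℝ) ^ δ) ^ a := by
        rw [← Real.rpow_natCast, ← Real.rpow_mul hp0, mul_comm, Real.rpow_mul hp0,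
          Real.rpow_natCast]
      rw [one_mul, h2]
      have h3 : ((a + 1 : ℕ) : ℝ) ≤ ((2 ^ a : ℕ) : ℝ) := by exact_mod_cast Nat.lt_two_pow_self
      push_cast at h3
      exact h3.trans (pow_le_pow_left₀ two_pos.le h1 a)
  have hprod : (n : ℝ) ^ δ = ∏ p ∈ n.primeFactors, ((p : ℝ) ^ n.factorization p) ^ δ := by
    rw [Real.finsetProd_rpow _ _ (fun p _ => by positivity)]
    congr 1
    conv_lhs => rw [← Nat.prod_factorization_pow_eq_self hn.ne']
    rw [Finsupp.prod]
    push_cast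
    rfl
  rw [Nat.card_divisors hn.ne', hprod]
  push_cast
  calc ∏ p ∈ n.primeFactors, ((n.factorization p : ℝ) + 1)
      ≤ ∏ p ∈ n.primeFactors, (if p < B then c else 1) * ((p : ℝ) ^ n.factorization p) ^ δ :=
        prod_le_prod (fun _ _ => by positivity)
          fun p hp => key p (Nat.prime_of_mem_primeFactors hp) _
    _ = (∏ p ∈ n.primeFactors, if p < B then c else 1) *
          ∏ p ∈ n.primeFactors, ((p : ℝ) ^ n.factorization p) ^ δ := prod_mul_distrib
    _ ≤ _ := by
        refine mul_le_mul_of_nonneg_right ?_ (prod_nonneg fun _ _ => by positivity)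
        rw [← prod_filter, prod_const]
        refine pow_le_pow_right₀ hc1 ?_
        calc #(n.primeFactors.filter (· < B)) ≤ #(range B) :=
              card_le_card fun p hp => mem_range.2 (mem_filter.1 hp).2
          _ = B := card_range B

/-- Bound the gcd by the sum of the common divisors; each `g ∣ n` then contributes `g ⌊M/g⌋ ≤ M`. -/
theorem sum_gcd_le {M n : ℕ} (hn : 0 < n) (S : Finset ℕ) (hS : S ⊆ Ioc 0 M) :
    ∑ m ∈ S, m.gcd n ≤ M * #n.divisors := by
  calc ∑ m ∈ S, m.gcd n ≤ ∑ m ∈ Ioc 0 M, m.gcd n :=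
        sum_le_sum_of_subset hS
    _ ≤ ∑ m ∈ Ioc 0 M, ∑ g ∈ n.divisors, if g ∣ m then g else 0 := by
        refine sum_le_sum fun m _ => ?_
        have := single_le_sum (f := fun g => if g ∣ m then g else 0) (fun _ _ => Nat.zero_le _)
          (Nat.mem_divisors.2 ⟨Nat.gcd_dvd_right m n, hn.ne'⟩)
        simpa [Nat.gcd_dvd_left] using this
    _ = ∑ g ∈ n.divisors, ∑ m ∈ Ioc 0 M, if g ∣ m then g else 0 := sum_comm
    _ ≤ ∑ _g ∈ n.divisors, M := by
        refine sum_le_sum fun g _ => ?_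
        rw [← sum_filter, sum_const, smul_eq_mul, Nat.Ioc_filter_dvd_card_eq_div]
        exact Nat.div_mul_le_self _ _
    _ = _ := by rw [sum_const, smul_eq_mul, mul_comm]

end DuffinSchaeffer

/-! ### Sieved fractions as torsion points of the circle. -/

namespace DuffinSchaeffer

open Finset MeasureTheory Metric
open scoped ENNReal

/-- The fractions `a / n` in `ℝ/ℤ` with `a` coprime to `gcd(n, P)`. For `P = 0` these are the
points of order `n`, and for `P = 1` the `n`-torsion points. -/
noncomputable def sievedFrac (P n : ℕ) : Finset UnitAddCircle :=
  {a ∈ range n | a.Coprime (n.gcd P)}.image fun a : ℕ => (((a : ℝ) / n : ℝ) : UnitAddCircle)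

theorem coe_nat_div_eq_zero_iff {a n : ℕ} (hn : 0 < n) :
    (((a : ℝ) / n : ℝ) : UnitAddCircle) = 0 ↔ n ∣ a := by
  rw [AddCircle.coe_eq_zero_iff]
  have hn' : (n : ℝ) ≠ 0 := by positivity
  constructor
  · rintro ⟨k, hk⟩
    rw [zsmul_eq_mul, mul_one, eq_div_iff hn'] at hk
    exact Int.natCast_dvd_natCast.1 ⟨k, by rw [mul_comm]; exact_mod_cast hk.symm⟩
  · rintro ⟨k, rfl⟩
    refine ⟨k, ?_⟩
    push_cast
    field_simp
    simp

/-- Trading numerators for torsion conditions makes the translation symmetries of the sieved set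
visible. -/
theorem mem_sievedFrac_iff {P n : ℕ} (hn : 0 < n) {c : UnitAddCircle} :
    c ∈ sievedFrac P n ↔
      n • c = 0 ∧ ∀ p : ℕ, p.Prime → p ∣ n → p ∣ P → (n / p) • c ≠ 0 := by
  have hn' : (n : ℝ) ≠ 0 := by positivity
  have key : ∀ a p : ℕ, p.Prime → p ∣ n →
      ((n / p) • (((a : ℝ) / n : ℝ) : UnitAddCircle) = 0 ↔ p ∣ a) := by
    intro a p hp hpn
    obtain ⟨q, rfl⟩ := hpn
    have hq : (q : ℝ) ≠ 0 := by
      rintro h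
      simp [h] at hn'
    have hp' : (p : ℝ) ≠ 0 := by
      rintro h
      simp [h] at hn'
    rw [Nat.mul_div_cancel_left _ hp.pos, ← AddCircle.coe_nsmul,
      ← coe_nat_div_eq_zero_iff hp.pos, nsmul_eq_mul]
    have : (q : ℝ) * (a / ((p * q : ℕ) : ℝ)) = a / p := by
      push_cast
      field_simp
    rw [this]
  simp only [sievedFrac, mem_image, mem_filter, mem_range]
  constructor
  · rintro ⟨a, ⟨han, hcop⟩, rfl⟩
    refine ⟨?_, fun p hp hpn hpP => ?_⟩
    · rw [← AddCircle.coe_nsmul, nsmul_eq_mul, mul_div_cancel₀ _ hn',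
        AddCircle.coe_eq_zero_iff]
      exact ⟨a, by simp⟩
    · rw [Ne, key a p hp hpn]
      intro hpa
      exact hp.one_lt.ne' (Nat.eq_one_of_dvd_coprimes hcop hpa (Nat.dvd_gcd hpn hpP))
  · rintro ⟨h0, h⟩
    obtain ⟨a, han, rfl⟩ := (AddCircle.nsmul_eq_zero_iff hn).1 h0
    simp only [mul_one] at h h0 ⊢
    refine ⟨a, ⟨han, ?_⟩, rfl⟩
    refine Nat.coprime_of_dvd fun p hp hpa hpg => ?_
    have hpn := hpg.trans (Nat.gcd_dvd_left _ _)
    exact h p hp hpn (hpg.trans (Nat.gcd_dvd_right _ _)) ((key a p hp hpn).2 hpa)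

theorem card_sievedFrac {P n : ℕ} (hn : 0 < n) :
    #(sievedFrac P n) = n / n.gcd P * (n.gcd P).totient := by
  rw [sievedFrac, card_image_of_injOn, ← card_filter_coprime_range_mul,
    Nat.div_mul_cancel (Nat.gcd_dvd_left _ _)]
  intro a ha b hb hab
  have hn' : (0 : ℝ) < n := by positivity
  have ha' : a < n := by simpa using (mem_filter.1 (mem_coe.1 ha)).1
  have hb' : b < n := by simpa using (mem_filter.1 (mem_coe.1 hb)).1
  have hmem : ∀ a : ℕ, a < n → (a : ℝ) / n ∈ Set.Ico (0 : ℝ) (0 + 1) := fun a ha =>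
    ⟨by positivity, by rw [zero_add, div_lt_one hn']; exact_mod_cast ha⟩
  have := (AddCircle.coe_eq_coe_iff_of_mem_Ico (hmem a ha') (hmem b hb')).1 hab
  rw [div_left_inj' hn'.ne'] at this
  exact_mod_cast this

theorem card_sievedFrac_zero {n : ℕ} (hn : 0 < n) : #(sievedFrac 0 n) = n.totient := by
  rw [card_sievedFrac hn, Nat.gcd_zero_right, Nat.div_self hn, one_mul]

theorem card_sievedFrac_one {n : ℕ} (hn : 0 < n) : #(sievedFrac 1 n) = n := by
  rw [card_sievedFrac hn, Nat.gcd_one_right, Nat.totient_one, Nat.div_one, mul_one]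

theorem mem_sievedFrac_one_iff {n : ℕ} (hn : 0 < n) {c : UnitAddCircle} :
    c ∈ sievedFrac 1 n ↔ n • c = 0 := by
  rw [mem_sievedFrac_iff hn, and_iff_left]
  intro p hp _ h1
  exact absurd (Nat.dvd_one.1 h1) hp.ne_one

theorem sievedFrac_zero_subset (P : ℕ) {n : ℕ} (hn : 0 < n) :
    sievedFrac 0 n ⊆ sievedFrac P n := by
  intro c hc
  rw [mem_sievedFrac_iff hn] at hc ⊢
  exact ⟨hc.1, fun p hp hpn _ => hc.2 p hp hpn (dvd_zero p)⟩

theorem addOrderOf_of_mem_sievedFrac_zero {n : ℕ} (hn : 0 < n) {c : UnitAddCircle}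
    (hc : c ∈ sievedFrac 0 n) : addOrderOf c = n := by
  rw [mem_sievedFrac_iff hn] at hc
  exact addOrderOf_eq_of_nsmul_and_div_prime_nsmul hn hc.1
    fun p hp hpn => hc.2 p hp hpn (dvd_zero p)

/-- If `p` divides both `n` and `P`, then `(n / p) * P` is a multiple of `n`, so the shift is
invisible to every sieving condition. -/
theorem add_mem_sievedFrac {P n : ℕ} (hn : 0 < n) {c w : UnitAddCircle} (hc : c ∈ sievedFrac P n)
    (hw : n • w = 0) : c + P • w ∈ sievedFrac P n := by
  rw [mem_sievedFrac_iff hn] at hc ⊢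
  refine ⟨?_, fun p hp hpn hpP => ?_⟩
  · rw [smul_add, hc.1, smul_comm, hw, smul_zero, add_zero]
  · have : (n / p) • (P • w) = 0 := by
      obtain ⟨q, rfl⟩ := hpn
      obtain ⟨Q, rfl⟩ := hpP
      rw [Nat.mul_div_cancel_left _ hp.pos, smul_smul, show q * (p * Q) = Q * (p * q) by ring,
        ← smul_smul, hw, smul_zero]
    rw [smul_add, this, add_zero]
    exact hc.2 p hp hpn hpP

theorem one_div_le_dist_of_nsmul_eq_zero {n : ℕ} (hn : 0 < n) {a b : UnitAddCircle}
    (ha : n • a = 0) (hb : n • b = 0) (hab : a ≠ b) : 1 / (n : ℝ) ≤ dist a b := by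
  have h0 : n • (a - b) = 0 := by rw [smul_sub, ha, hb, sub_zero]
  have h := AddCircle.le_add_order_smul_norm_of_isOfFinAddOrder
    (isOfFinAddOrder_iff_nsmul_eq_zero.2 ⟨n, hn, h0⟩) (sub_ne_zero.2 hab)
  have h2 : addOrderOf (a - b) ≤ n := addOrderOf_le_of_nsmul_eq_zero hn h0
  rw [div_le_iff₀ (by positivity), dist_eq_norm, mul_comm]
  rw [nsmul_eq_mul] at h
  exact h.trans (by gcongr)

/-! ### Counting functions of balls. -/

theorem volume_ball_unitAddCircle (x : UnitAddCircle) (r : ℝ) :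
    volume (ball x r) = ENNReal.ofReal (min 1 (2 * r)) := by
  rw [← measure_congr AddCircle.closedBall_ae_eq_ball, AddCircle.volume_closedBall]

/-- The number of balls of radius `r` with centre in `C` that contain `x`. -/
noncomputable def ballCount (C : Finset UnitAddCircle) (r : ℝ) (x : UnitAddCircle) : ℝ≥0∞ :=
  ∑ c ∈ C, (ball c r).indicator 1 x

theorem measurable_ballCount (C : Finset UnitAddCircle) (r : ℝ) : Measurable (ballCount C r) := by
  unfold ballCount
  exact Finset.measurable_fun_sum _ fun c _ => measurable_one.indicator measurableSet_ball

theorem lintegral_ballCount (C : Finset UnitAddCircle) (r : ℝ) :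
    ∫⁻ x, ballCount C r x = #C * ENNReal.ofReal (min 1 (2 * r)) := by
  unfold ballCount
  rw [lintegral_finsetSum _ fun c _ => measurable_one.indicator measurableSet_ball]
  simp_rw [lintegral_indicator_one measurableSet_ball, volume_ball_unitAddCircle, sum_const,
    nsmul_eq_mul]

theorem lintegral_ballCount_le (C : Finset UnitAddCircle) (r : ℝ) :
    ∫⁻ x, ballCount C r x ≤ ENNReal.ofReal (#C * (2 * r)) := by
  rw [lintegral_ballCount, ENNReal.ofReal_mul (Nat.cast_nonneg _), ENNReal.ofReal_natCast]
  gcongr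
  exact min_le_right _ _

theorem ballCount_mono {C D : Finset UnitAddCircle} (h : C ⊆ D) (r : ℝ) (x : UnitAddCircle) :
    ballCount C r x ≤ ballCount D r x :=
  sum_le_sum_of_subset h

theorem ballCount_add {C : Finset UnitAddCircle} {t : UnitAddCircle} (h : ∀ c ∈ C, c + t ∈ C)
    (r : ℝ) (x : UnitAddCircle) : ballCount C r (x + t) = ballCount C r x := by
  have himg : C.image (· + t) = C := by
    refine eq_of_subset_of_card_le (image_subset_iff.2 h) ?_
    rw [card_image_of_injective _ (add_left_injective t)]
  unfold ballCount
  conv_lhs => rw [← himg]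
  rw [sum_image fun a _ b _ hab => add_left_injective t hab]
  refine sum_congr rfl fun c _ => ?_
  simp only [Set.indicator, mem_ball, dist_add_right, Pi.one_apply]

/-- Packing: distinct `K`-torsion points are `1/K` apart, so balls of radius `1/(2K)` about the
counted centres are disjoint and lie in a ball of radius `r + 1/(2K)` about `x`. -/
theorem ballCount_le_of_separated {C : Finset UnitAddCircle} {K : ℕ} (hK : 0 < K)
    (hC : ∀ c ∈ C, K • c = 0) {r : ℝ} (hr : 0 ≤ r) (x : UnitAddCircle) :
    ballCount C r x ≤ ENNReal.ofReal (2 * K * r + 1) := by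
  classical
  have hK' : (0 : ℝ) < K := by positivity
  set F := {c ∈ C | x ∈ ball c r} with hF
  have h1 : ballCount C r x = #F := by
    simp [ballCount, Set.indicator, hF]
  have hdisj : (F : Set UnitAddCircle).PairwiseDisjoint fun c => ball c (1 / (2 * K : ℝ)) := by
    intro a ha b hb hab
    have ha' := hC a (mem_filter.1 (mem_coe.1 ha)).1
    have hb' := hC b (mem_filter.1 (mem_coe.1 hb)).1
    refine ball_disjoint_ball ?_
    have := one_div_le_dist_of_nsmul_eq_zero hK ha' hb' hab
    refine le_trans (le_of_eq ?_) this
    field_simp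
    norm_num
  have h2 : volume (⋃ c ∈ F, ball c (1 / (2 * K : ℝ))) ≤
      volume (ball x (r + 1 / (2 * K : ℝ))) := by
    refine measure_mono (Set.iUnion₂_subset fun c hc => ball_subset_ball' ?_)
    have := (mem_filter.1 hc).2
    rw [mem_ball, dist_comm] at this
    linarith
  rw [measure_biUnion_finset hdisj fun _ _ => measurableSet_ball] at h2
  simp_rw [volume_ball_unitAddCircle, sum_const, nsmul_eq_mul] at h2
  have hmin : min 1 (2 * (1 / (2 * K : ℝ))) = 1 / K := by
    rw [show 2 * (1 / (2 * K : ℝ)) = 1 / K by field_simp, min_eq_right]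
    rw [div_le_one hK']
    exact_mod_cast hK
  rw [hmin, ← ENNReal.ofReal_natCast, ← ENNReal.ofReal_mul (Nat.cast_nonneg _)] at h2
  have h3 := (ENNReal.ofReal_le_ofReal_iff (by positivity)).1 h2
  have h4 : (#F : ℝ) * (1 / K) ≤ 2 * (r + 1 / (2 * K)) := h3.trans (min_le_right _ _)
  rw [h1, ← ENNReal.ofReal_natCast]
  refine ENNReal.ofReal_le_ofReal ?_
  have h5 : (#F : ℝ) = #F * (1 / K) * K := by field_simp
  rw [h5]
  calc (#F : ℝ) * (1 / K) * K ≤ 2 * (r + 1 / (2 * K)) * K := by gcongr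
    _ = 2 * K * r + 1 := by field_simp

/-! ### Overlap of two denominators. -/

/-- A torsion point of the period of the pair of sieved sets splits into periods of the two. -/
theorem exists_add_eq_of_nsmul_eq_zero {m n P : ℕ} (hm : 0 < m) (hn : 0 < n) (hP : 0 < P)
    {t : UnitAddCircle} (ht : (m.lcm n / P.gcd (m.lcm n)) • t = 0) :
    ∃ u v : UnitAddCircle, m • u = 0 ∧ n • v = 0 ∧ t = P • u + P • v := by
  set L := m.lcm n with hL
  set h := P.gcd L with hh
  have hh0 : 0 < h := Nat.gcd_pos_of_pos_left _ hP
  have hhL : h ∣ L := Nat.gcd_dvd_right _ _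
  obtain ⟨w, hw⟩ : ∃ w : UnitAddCircle, h • w = t := by
    obtain ⟨x, rfl⟩ := QuotientAddGroup.mk_surjective t
    refine ⟨((x / h : ℝ) : UnitAddCircle), ?_⟩
    rw [← AddCircle.coe_nsmul, nsmul_eq_mul, mul_div_cancel₀ _ (by positivity)]
  have hLw : L • w = 0 := by
    rw [← Nat.div_mul_cancel hhL, ← smul_smul, hw, ht]
  have hLw' : (L : ℤ) • w = 0 := by rw [natCast_zsmul, hLw]
  obtain ⟨a, ha⟩ : m ∣ L := Nat.dvd_lcm_left _ _
  obtain ⟨b, hb⟩ : n ∣ L := Nat.dvd_lcm_right _ _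
  have hcop : IsCoprime (a : ℤ) b := by
    rw [Nat.isCoprime_iff_coprime]
    have hg : 0 < m.gcd n := Nat.gcd_pos_of_pos_left _ hm
    have h1 := Nat.gcd_mul_lcm m n
    rw [← hL] at h1
    have ha2 : n = m.gcd n * a := by
      refine Nat.eq_of_mul_eq_mul_left hm ?_
      rw [← h1, ha]; ring
    have hb2 : m = m.gcd n * b := by
      refine Nat.eq_of_mul_eq_mul_left hn ?_
      rw [mul_comm n m, ← h1, hb]; ring
    have h2 : m.gcd n * 1 = m.gcd n * Nat.gcd a b := by
      rw [← Nat.gcd_mul_left, ← ha2, ← hb2, mul_one, Nat.gcd_comm]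
    exact (Nat.eq_of_mul_eq_mul_left hg h2).symm
  -- Two Bézout relations combine: `x a + y b = 1` separates the periods of `m` and `n`, and `h = P
  -- α + L β` brings in the factor `P`, the term in `L` killing `w`.
  obtain ⟨x, y, hxy⟩ := hcop
  have hbez := Nat.gcd_eq_gcd_ab P L
  set α := P.gcdA L
  set β := P.gcdB L
  refine ⟨(α * x * a) • w, (α * y * b) • w, ?_, ?_, ?_⟩
  · rw [← natCast_zsmul, smul_smul, show (m : ℤ) * (α * x * a) = α * x * L by
      rw [ha]; push_cast; ring, ← smul_smul, hLw', smul_zero]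
  · rw [← natCast_zsmul, smul_smul, show (n : ℤ) * (α * y * b) = α * y * L by
      rw [hb]; push_cast; ring, ← smul_smul, hLw', smul_zero]
  · rw [← hw, ← natCast_zsmul, ← natCast_zsmul, ← natCast_zsmul, smul_smul, smul_smul, ← add_smul,
      hh, hbez, show (P : ℤ) * (α * x * a) + P * (α * y * b) = P * α * (x * a + y * b) by ring,
      hxy, mul_one, add_smul, mul_comm (L : ℤ), ← smul_smul β, hLw', smul_zero, add_zero]

theorem sum_ballCount_add_le {C : Finset UnitAddCircle} {K : ℕ} (hK : 0 < K) {r : ℝ} (hr : 0 ≤ r)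
    (x : UnitAddCircle) :
    ∑ t ∈ sievedFrac 1 K, ballCount C r (x + t) ≤ #C * ENNReal.ofReal (2 * K * r + 1) := by
  unfold ballCount
  rw [sum_comm, ← nsmul_eq_mul]
  refine sum_le_card_nsmul _ _ _ fun c _ => ?_
  refine le_trans (le_of_eq ?_) (ballCount_le_of_separated (C := sievedFrac 1 K) hK
    (fun c hc => (mem_sievedFrac_one_iff hK).1 hc) hr (c - x))
  refine sum_congr rfl fun t _ => ?_
  simp only [Set.indicator, mem_ball, dist_eq_norm, Pi.one_apply]
  rw [← norm_neg, show -(x + t - c) = c - x - t by abel]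

/-- Translating one factor by a `K`-torsion point leaves the correlation unchanged, since the shift
splits into a period of each factor. It thus equals its average over these shifts, where packing
applies. The hypothesis `h` says that a ball of radius `s` is at least as wide as the spacing `1/K`,
so `2Ks + 1 ≤ 4Ks`; with the factor `2r` from the first integral this gives the constant 8. -/
theorem lintegral_ballCount_mul_le {m n P : ℕ} (hm : 0 < m) (hn : 0 < n) (hP : 0 < P) {r s : ℝ}
    (hr : 0 ≤ r) (hs : 0 ≤ s) (h : (P : ℝ) ≤ 2 * m.lcm n * s) :
    ∫⁻ x, ballCount (sievedFrac P m) r x * ballCount (sievedFrac P n) s x ≤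
      ENNReal.ofReal (8 * #(sievedFrac P m) * #(sievedFrac P n) * r * s) := by
  set L := m.lcm n with hL
  set K := L / P.gcd L with hK
  have hL0 : 0 < L := Nat.lcm_pos hm hn
  have hg0 : 0 < P.gcd L := Nat.gcd_pos_of_pos_left _ hP
  have hK0 : 0 < K := Nat.div_pos (Nat.le_of_dvd hL0 (Nat.gcd_dvd_right _ _)) hg0
  have hKL : K * P.gcd L = L := Nat.div_mul_cancel (Nat.gcd_dvd_right _ _)
  set f := ballCount (sievedFrac P m) r with hf
  set g := ballCount (sievedFrac P n) s with hg
  have hfm : Measurable f := measurable_ballCount _ _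
  have hgm : Measurable g := measurable_ballCount _ _
  have hinv : ∀ t ∈ sievedFrac 1 K, ∫⁻ x, f x * g (x + t) = ∫⁻ x, f x * g x := by
    intro t ht
    rw [mem_sievedFrac_one_iff hK0] at ht
    obtain ⟨u, v, hu, hv, rfl⟩ := exists_add_eq_of_nsmul_eq_zero hm hn hP ht
    rw [← lintegral_add_right_eq_self (fun x => f x * g x) (P • u)]
    refine lintegral_congr fun x => ?_
    rw [← add_assoc, hg, ballCount_add fun c hc => add_mem_sievedFrac hn hc hv, hf,
      ballCount_add fun c hc => add_mem_sievedFrac hm hc hu]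
  have hsum : (K : ℝ≥0∞) * ∫⁻ x, f x * g x = ∫⁻ x, f x * ∑ t ∈ sievedFrac 1 K, g (x + t) := by
    simp_rw [mul_sum]
    rw [lintegral_finsetSum (f := fun t x => f x * g (x + t)) _ fun t _ =>
      hfm.mul (hgm.comp (measurable_id.add_const t)), sum_congr rfl hinv, sum_const,
      card_sievedFrac_one hK0, nsmul_eq_mul]
  have hKs : 1 ≤ 2 * K * s := by
    have h1 : (P : ℝ) ≤ 2 * K * s * P := by
      calc (P : ℝ) ≤ 2 * L * s := h
        _ = 2 * (K * P.gcd L : ℕ) * s := by rw [hKL]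
        _ = 2 * K * s * P.gcd L := by push_cast; ring
        _ ≤ 2 * K * s * P := by
          gcongr
          exact Nat.gcd_le_left _ hP
    have hP' : (0 : ℝ) < P := by positivity
    nlinarith
  have hle : (K : ℝ≥0∞) * ∫⁻ x, f x * g x ≤
      K * ENNReal.ofReal (8 * #(sievedFrac P m) * #(sievedFrac P n) * r * s) := by
    calc (K : ℝ≥0∞) * ∫⁻ x, f x * g x = ∫⁻ x, f x * ∑ t ∈ sievedFrac 1 K, g (x + t) := hsum
      _ ≤ ∫⁻ x, f x * (#(sievedFrac P n) * ENNReal.ofReal (2 * K * s + 1)) := by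
        refine lintegral_mono fun x => ?_
        gcongr
        exact sum_ballCount_add_le hK0 hs x
      _ = (∫⁻ x, f x) * (#(sievedFrac P n) * ENNReal.ofReal (2 * K * s + 1)) :=
        lintegral_mul_const _ hfm
      _ ≤ ENNReal.ofReal (#(sievedFrac P m) * (2 * r)) *
          (#(sievedFrac P n) * ENNReal.ofReal (2 * K * s + 1)) := by
        gcongr
        exact lintegral_ballCount_le _ _
      _ = ENNReal.ofReal (#(sievedFrac P m) * (2 * r) * (#(sievedFrac P n) * (2 * K * s + 1))) := by
        rw [← ENNReal.ofReal_natCast #(sievedFrac P n), ← ENNReal.ofReal_mul (by positivity),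
          ← ENNReal.ofReal_mul (by positivity)]
      _ ≤ ENNReal.ofReal (K * (8 * #(sievedFrac P m) * #(sievedFrac P n) * r * s)) := by
        refine ENNReal.ofReal_le_ofReal ?_
        calc (#(sievedFrac P m) : ℝ) * (2 * r) * (#(sievedFrac P n) * (2 * K * s + 1))
            ≤ #(sievedFrac P m) * (2 * r) * (#(sievedFrac P n) * (2 * K * s + 2 * K * s)) := by
              gcongr
          _ = _ := by ring
      _ = _ := by rw [ENNReal.ofReal_mul (Nat.cast_nonneg _), ENNReal.ofReal_natCast]
  exact (ENNReal.mul_le_mul_iff_right (by exact_mod_cast hK0.ne') (ENNReal.natCast_ne_top K)).1 hle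

/-- Points of different exact orders are distinct, and both are torsion for the lcm, so they are at
least `1 / lcm` apart. -/
theorem ballCount_mul_eq_zero {m n : ℕ} (hm : 0 < m) (hn : 0 < n) (hmn : m ≠ n) {r s : ℝ}
    (h : m.lcm n * (r + s) ≤ 1) (x : UnitAddCircle) :
    ballCount (sievedFrac 0 m) r x * ballCount (sievedFrac 0 n) s x = 0 := by
  have hL0 : 0 < m.lcm n := Nat.lcm_pos hm hn
  unfold ballCount
  rw [sum_mul_sum]
  refine sum_eq_zero fun c hc => sum_eq_zero fun d hd => ?_
  have hco := addOrderOf_of_mem_sievedFrac_zero hm hc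
  have hdo := addOrderOf_of_mem_sievedFrac_zero hn hd
  have hcd : c ≠ d := by
    rintro rfl
    exact hmn (hco.symm.trans hdo)
  have h1 := one_div_le_dist_of_nsmul_eq_zero hL0 (a := c) (b := d)
    (addOrderOf_dvd_iff_nsmul_eq_zero.1 (hco ▸ Nat.dvd_lcm_left _ _))
    (addOrderOf_dvd_iff_nsmul_eq_zero.1 (hdo ▸ Nat.dvd_lcm_right _ _)) hcd
  have h2 : r + s ≤ 1 / (m.lcm n : ℝ) := by
    rw [le_div_iff₀ (by positivity), mul_comm]
    exact h
  have hdis : Disjoint (ball c r) (ball d s) := ball_disjoint_ball (h2.trans h1)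
  by_cases hx : x ∈ ball c r
  · rw [Set.indicator_of_notMem (Set.disjoint_left.1 hdis hx), mul_zero]
  · rw [Set.indicator_of_notMem hx, zero_mul]

/-- Three regimes for `X = 2 lcm(m, n) max(ρ m, ρ n)`. If `X ≥ P`, the sieved sets are
quasi-independent. If `1 ≤ X < P`, all torsion points are used (sieve level 1), and `mn = gcd * lcm`
turns the bound into the gcd term. If `X < 1`, distinct denominators do not overlap. The diagonal
with `X < P` is bounded by packing. -/
theorem lintegral_overlap_le {P : ℕ} (hP : 0 < P) {A : ℝ} (ρ : ℕ → ℝ) (hρ : ∀ n, 0 ≤ ρ n)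
    {m n : ℕ} (hm : 0 < m) (hn : 0 < n) (hA : 0 ≤ A)
    (hAm : (#(sievedFrac P m) : ℝ) ≤ A * m.totient)
    (hAn : (#(sievedFrac P n) : ℝ) ≤ A * n.totient) :
    ∫⁻ x, ballCount (sievedFrac 0 m) (ρ m) x * ballCount (sievedFrac 0 n) (ρ n) x ≤
      ENNReal.ofReal (8 * A ^ 2 * (m.totient * ρ m) * (n.totient * ρ n) +
        4 * P * m.gcd n * ρ n) := by
  have hρm := hρ m
  have hρn := hρ n
  have hsub : ∀ Q : ℕ,
      ∫⁻ x, ballCount (sievedFrac 0 m) (ρ m) x * ballCount (sievedFrac 0 n) (ρ n) x ≤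
      ∫⁻ x, ballCount (sievedFrac Q m) (ρ m) x * ballCount (sievedFrac Q n) (ρ n) x := fun Q =>
    lintegral_mono fun x => mul_le_mul' (ballCount_mono (sievedFrac_zero_subset Q hm) _ _)
      (ballCount_mono (sievedFrac_zero_subset Q hn) _ _)
  have hboth : ∀ Q : ℕ, 0 < Q → (Q : ℝ) ≤ 2 * m.lcm n * max (ρ m) (ρ n) →
      ∫⁻ x, ballCount (sievedFrac 0 m) (ρ m) x * ballCount (sievedFrac 0 n) (ρ n) x ≤
      ENNReal.ofReal (8 * #(sievedFrac Q m) * #(sievedFrac Q n) * ρ m * ρ n) := by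
    intro Q hQ h
    refine (hsub Q).trans ?_
    rcases le_total (ρ m) (ρ n) with hle | hle
    · rw [max_eq_right hle] at h
      exact lintegral_ballCount_mul_le hm hn hQ hρm hρn h
    · rw [max_eq_left hle, Nat.lcm_comm] at h
      have := lintegral_ballCount_mul_le hn hm hQ hρn hρm h
      simp_rw [mul_comm (ballCount (sievedFrac Q m) _ _)]
      refine this.trans (le_of_eq ?_)
      congr 1
      ring
  by_cases hgood : (P : ℝ) ≤ 2 * m.lcm n * max (ρ m) (ρ n)
  · refine (hboth P hP hgood).trans (ENNReal.ofReal_le_ofReal ?_)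
    calc 8 * (#(sievedFrac P m) : ℝ) * #(sievedFrac P n) * ρ m * ρ n
        ≤ 8 * (A * m.totient) * (A * n.totient) * ρ m * ρ n := by gcongr
      _ = 8 * A ^ 2 * (m.totient * ρ m) * (n.totient * ρ n) := by ring
      _ ≤ _ := le_add_of_nonneg_right (by positivity)
  push Not at hgood
  have hfirst : 0 ≤ 8 * A ^ 2 * (m.totient * ρ m) * (n.totient * ρ n) := by positivity
  rcases eq_or_ne m n with rfl | hmn
  · rw [Nat.lcm_self, max_self] at hgood
    calc ∫⁻ x, ballCount (sievedFrac 0 m) (ρ m) x * ballCount (sievedFrac 0 m) (ρ m) x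
        ≤ ∫⁻ x, ENNReal.ofReal (2 * m * ρ m + 1) * ballCount (sievedFrac 0 m) (ρ m) x := by
          refine lintegral_mono fun x => ?_
          gcongr
          exact ballCount_le_of_separated hm
            (fun c hc => ((mem_sievedFrac_iff hm).1 hc).1) hρm x
      _ = ENNReal.ofReal (2 * m * ρ m + 1) * ∫⁻ x, ballCount (sievedFrac 0 m) (ρ m) x :=
          lintegral_const_mul _ (measurable_ballCount _ _)
      _ ≤ ENNReal.ofReal (2 * m * ρ m + 1) * ENNReal.ofReal (m.totient * (2 * ρ m)) := by
          gcongr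
          refine (lintegral_ballCount_le _ _).trans (le_of_eq ?_)
          rw [card_sievedFrac_zero hm]
      _ = ENNReal.ofReal ((2 * m * ρ m + 1) * (m.totient * (2 * ρ m))) := by
          rw [← ENNReal.ofReal_mul (by positivity)]
      _ ≤ _ := by
          refine ENNReal.ofReal_le_ofReal ?_
          have hP1 : (1 : ℝ) ≤ P := by exact_mod_cast hP
          have htot : (m.totient : ℝ) ≤ m := by exact_mod_cast Nat.totient_le m
          calc (2 * m * ρ m + 1) * (m.totient * (2 * ρ m))
              ≤ (P + P) * (m * (2 * ρ m)) := by gcongr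
            _ = 4 * P * m.gcd m * ρ m := by rw [Nat.gcd_self]; ring
            _ ≤ _ := le_add_of_nonneg_left hfirst
  · by_cases h1 : ((1 : ℕ) : ℝ) ≤ 2 * m.lcm n * max (ρ m) (ρ n)
    · refine (hboth 1 one_pos h1).trans (ENNReal.ofReal_le_ofReal ?_)
      rw [card_sievedFrac_one hm, card_sievedFrac_one hn]
      have hgl : (m : ℝ) * n = m.gcd n * m.lcm n := by exact_mod_cast (Nat.gcd_mul_lcm m n).symm
      have h2 : 2 * m.lcm n * ρ m ≤ (P : ℝ) :=
        le_trans (by gcongr; exact le_max_left _ _) hgood.le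
      calc 8 * (m : ℝ) * n * ρ m * ρ n = 8 * (m * n) * ρ m * ρ n := by ring
        _ = 4 * (2 * m.lcm n * ρ m) * m.gcd n * ρ n := by rw [hgl]; ring
        _ ≤ 4 * P * m.gcd n * ρ n := by gcongr
        _ ≤ _ := le_add_of_nonneg_left hfirst
    · push Not at h1
      rw [lintegral_congr (ballCount_mul_eq_zero hm hn hmn ?_)]
      · simp
      · have h3 : ρ m + ρ n ≤ 2 * max (ρ m) (ρ n) := by
          linarith [le_max_left (ρ m) (ρ n), le_max_right (ρ m) (ρ n)]
        calc (m.lcm n : ℝ) * (ρ m + ρ n) ≤ m.lcm n * (2 * max (ρ m) (ρ n)) := by gcongr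
          _ ≤ 1 := by push_cast at h1; linarith

end DuffinSchaeffer

/-! ### Second moment, dyadic blocks and the limsup set. -/

namespace DuffinSchaeffer

open Finset MeasureTheory Metric Filter Topology
open scoped ENNReal

theorem measurableSet_approxAddOrderOf (n : ℕ) (r : ℝ) :
    MeasurableSet (approxAddOrderOf UnitAddCircle n r) :=
  isOpen_thickening.measurableSet

/-- The second moment method for the union of the sets of points close to a fraction of
denominator in `S`. -/
theorem le_volume_iUnion_of_second_moment {S : Finset ℕ} (hS : ∀ n ∈ S, 0 < n) {ρ : ℕ → ℝ}
    (hρ : ∀ n, 0 ≤ ρ n) (hρ1 : ∀ n ∈ S, 2 * ρ n ≤ 1) {M B : ℝ} (hM : 0 < M) (hB : 0 < B)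
    (hMS : M = ∑ n ∈ S, n.totient * ρ n)
    (h2 : ∑ m ∈ S, ∑ n ∈ S,
      ∫⁻ x, ballCount (sievedFrac 0 m) (ρ m) x * ballCount (sievedFrac 0 n) (ρ n) x ≤
        ENNReal.ofReal (B * M ^ 2)) :
    ENNReal.ofReal (3 / B) ≤ volume (⋃ n ∈ S, approxAddOrderOf UnitAddCircle n (ρ n)) := by
  set U := ⋃ n ∈ S, approxAddOrderOf UnitAddCircle n (ρ n) with hU
  have hUm : MeasurableSet U :=
    Finset.measurableSet_biUnion _ fun n _ => measurableSet_approxAddOrderOf n _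
  set F : UnitAddCircle → ℝ≥0∞ := fun x => ∑ n ∈ S, ballCount (sievedFrac 0 n) (ρ n) x with hF
  have hFm : Measurable F := Finset.measurable_fun_sum _ fun n _ => measurable_ballCount _ _
  have hF1 : ∫⁻ x, F x = ENNReal.ofReal (2 * M) := by
    rw [hF, lintegral_finsetSum _ fun n _ => measurable_ballCount _ _, hMS, mul_sum,
      ENNReal.ofReal_sum_of_nonneg fun n _ => by have := hρ n; positivity]
    refine sum_congr rfl fun n hn => ?_
    rw [lintegral_ballCount, card_sievedFrac_zero (hS n hn), min_eq_right (hρ1 n hn),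
      ← ENNReal.ofReal_natCast, ← ENNReal.ofReal_mul (Nat.cast_nonneg _)]
    congr 1
    ring
  have hF2 : ∫⁻ x, F x ^ 2 ≤ ENNReal.ofReal (B * M ^ 2) := by
    refine le_trans (le_of_eq ?_) h2
    simp_rw [hF, sq, sum_mul_sum]
    have hmn : ∀ m n, Measurable fun x =>
        ballCount (sievedFrac 0 m) (ρ m) x * ballCount (sievedFrac 0 n) (ρ n) x := fun m n =>
      (measurable_ballCount _ _).mul (measurable_ballCount _ _)
    rw [lintegral_finsetSum _ fun m _ => Finset.measurable_fun_sum _ fun n _ => hmn m n]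
    exact sum_congr rfl fun m _ => lintegral_finsetSum _ fun n _ => hmn m n
  -- A pointwise form of Cauchy–Schwarz: `F` vanishes off `U`, and on `U` this is `2tF ≤ F² + t²`.
  have hpt : ∀ t : NNReal, ∀ x, 2 * t * F x ≤ F x ^ 2 + t ^ 2 * U.indicator 1 x := by
    intro t x
    by_cases hx : x ∈ U
    · rw [Set.indicator_of_mem hx, Pi.one_apply, mul_one]
      by_cases htop : F x = ⊤
      · simp [htop]
      · lift F x to NNReal using htop with a
        have := two_mul_le_add_sq t a
        rw [add_comm]
        exact_mod_cast this
    · have : F x = 0 := by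
        refine sum_eq_zero fun n hn => sum_eq_zero fun c hc => Set.indicator_of_notMem ?_ _
        intro hxc
        refine hx (Set.mem_biUnion hn ?_)
        exact mem_approx_add_orderOf_iff.2
          ⟨c, addOrderOf_of_mem_sievedFrac_zero (hS n hn) hc, hxc⟩
      simp [this]
  -- For `t = BM` the integrated inequality reads `4BM² ≤ BM² + B²M² vol(U)`, whence `3/B`.
  have hmain := lintegral_mono (μ := volume) (hpt (Real.toNNReal (B * M)))
  have hBM : 0 < B * M := mul_pos hB hM
  rw [lintegral_const_mul _ hFm, lintegral_add_left (hFm.pow_const 2),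
    lintegral_const_mul _ (measurable_one.indicator hUm), lintegral_indicator_one hUm, hF1] at hmain
  have hmain2 := hmain.trans (add_le_add_left hF2 _)
  set u := volume.real U with hu
  have hvol : volume U = ENNReal.ofReal u :=
    (ofReal_measureReal (measure_ne_top _ _)).symm
  have hu0 : 0 ≤ u := measureReal_nonneg
  change 2 * ENNReal.ofReal (B * M) * _ ≤ _ + ENNReal.ofReal (B * M) ^ 2 * _ at hmain2
  rw [hvol, ← ENNReal.ofReal_pow hBM.le, ← ENNReal.ofReal_mul (by positivity),
    ← ENNReal.ofReal_add (by positivity) (by positivity),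
    ← ENNReal.ofReal_ofNat 2, ← ENNReal.ofReal_mul (by positivity),
    ← ENNReal.ofReal_mul (by positivity),
    ENNReal.ofReal_le_ofReal_iff (by positivity)] at hmain2
  rw [hvol]
  refine ENNReal.ofReal_le_ofReal ?_
  rw [div_le_iff₀ hB]
  have h3 : 3 * (B * M ^ 2) ≤ u * B * (B * M ^ 2) := by nlinarith
  exact le_of_mul_le_mul_right h3 (by positivity)

/-- The main overlap terms sum to `8A²M²`. In the gcd terms, `2^(k+1) ≤ 2n ≤ 2φ(n)d(n)` gives a
total of at most `8PD²M ≤ 8M²`. The resulting bound depends on `κ` alone. -/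
theorem le_volume_dyadic_iUnion {k y : ℕ} {κ D M : ℝ} {ρ : ℕ → ℝ} (hy : 1 ≤ y)
    (hk : (k : ℝ) ≤ κ * (y + 1)) (hρ : ∀ n, 0 ≤ ρ n)
    (hρ1 : ∀ n ∈ Ico (2 ^ k) (2 ^ (k + 1)), 2 * ρ n ≤ 1)
    (hD : ∀ n ∈ Ico (2 ^ k) (2 ^ (k + 1)), (#n.divisors : ℝ) ≤ D) (hM : 0 < M)
    (hMS : M = ∑ n ∈ Ico (2 ^ k) (2 ^ (k + 1)), n.totient * ρ n)
    (hPD : primorial y * D ^ 2 ≤ M) :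
    ENNReal.ofReal (3 / (8 * Real.exp (2 * κ) ^ 2 + 8)) ≤
      volume (⋃ n ∈ Ico (2 ^ k) (2 ^ (k + 1)), approxAddOrderOf UnitAddCircle n (ρ n)) := by
  set S := Ico (2 ^ k) (2 ^ (k + 1)) with hS
  set P := primorial y with hP
  set A := Real.exp (2 * κ) with hA
  have hP0 : 0 < P := primorial_pos y
  have hpos : ∀ n ∈ S, 0 < n := fun n hn =>
    lt_of_lt_of_le (by positivity) (mem_Ico.1 hn).1
  have hsieve : ∀ n ∈ S, (#(sievedFrac P n) : ℝ) ≤ A * n.totient := fun n hn => by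
    rw [card_sievedFrac (hpos n hn)]
    exact sieved_card_le (hpos n hn) (mem_Ico.1 hn).2 hy hk
  refine le_volume_iUnion_of_second_moment hpos hρ hρ1 hM (by positivity) hMS ?_
  have hbound : ∑ m ∈ S, ∑ n ∈ S, ENNReal.ofReal
      (8 * A ^ 2 * (m.totient * ρ m) * (n.totient * ρ n) + 4 * P * m.gcd n * ρ n) =
      ENNReal.ofReal (∑ m ∈ S, ∑ n ∈ S,
        (8 * A ^ 2 * (m.totient * ρ m) * (n.totient * ρ n) + 4 * P * m.gcd n * ρ n)) := by
    have hnn : ∀ m n : ℕ, 0 ≤ 8 * A ^ 2 * (m.totient * ρ m) * (n.totient * ρ n) +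
        4 * P * m.gcd n * ρ n := fun m n => by
      have := hρ m
      have := hρ n
      positivity
    rw [ENNReal.ofReal_sum_of_nonneg fun m _ => sum_nonneg fun n _ => hnn m n]
    refine sum_congr rfl fun m _ => ?_
    rw [ENNReal.ofReal_sum_of_nonneg fun n _ => hnn m n]
  refine (sum_le_sum fun m hm => sum_le_sum fun n hn => lintegral_overlap_le hP0 ρ hρ
    (hpos m hm) (hpos n hn) (Real.exp_pos _).le (hsieve m hm) (hsieve n hn)).trans ?_
  rw [hbound]
  refine ENNReal.ofReal_le_ofReal ?_
  have h1 : ∑ m ∈ S, ∑ n ∈ S, 8 * A ^ 2 * (m.totient * ρ m) * (n.totient * ρ n) =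
      8 * A ^ 2 * M ^ 2 := by
    simp_rw [← mul_sum, ← sum_mul, ← mul_sum, ← hMS]
    ring
  have h2 : ∑ m ∈ S, ∑ n ∈ S, 4 * P * (m.gcd n : ℝ) * ρ n ≤ 8 * M ^ 2 := by
    rw [sum_comm]
    calc ∑ n ∈ S, ∑ m ∈ S, 4 * P * (m.gcd n : ℝ) * ρ n
        = ∑ n ∈ S, 4 * P * ((∑ m ∈ S, m.gcd n : ℕ) : ℝ) * ρ n := by
          refine sum_congr rfl fun n _ => ?_
          rw [Nat.cast_sum, mul_sum, sum_mul]
      _ ≤ ∑ n ∈ S, 8 * (P * D ^ 2) * (n.totient * ρ n) := by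
          refine sum_le_sum fun n hn => ?_
          have hρn := hρ n
          have hD0 : (0 : ℝ) ≤ D := (Nat.cast_nonneg _).trans (hD n hn)
          have hg : ∑ m ∈ S, m.gcd n ≤ 2 ^ (k + 1) * #n.divisors := by
            refine sum_gcd_le (hpos n hn) S fun m hm => ?_
            exact mem_Ioc.2 ⟨hpos m hm, (mem_Ico.1 hm).2.le⟩
          have h2n : 2 ^ (k + 1) ≤ 2 * (n.totient * #n.divisors) := by
            have := (mem_Ico.1 hn).1
            have := le_totient_mul_card_divisors (hpos n hn)
            rw [pow_succ]
            omega
          have hg' : ((∑ m ∈ S, m.gcd n : ℕ) : ℝ) ≤ 2 * n.totient * D ^ 2 := by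
            calc ((∑ m ∈ S, m.gcd n : ℕ) : ℝ)
                ≤ ((2 * (n.totient * #n.divisors) * #n.divisors : ℕ) : ℝ) := by
                  exact_mod_cast hg.trans (Nat.mul_le_mul_right _ h2n)
              _ = 2 * n.totient * (#n.divisors : ℝ) ^ 2 := by push_cast; ring
              _ ≤ _ := by
                  gcongr
                  exact hD n hn
          calc 4 * P * ((∑ m ∈ S, m.gcd n : ℕ) : ℝ) * ρ n
              ≤ 4 * P * (2 * n.totient * D ^ 2) * ρ n := by gcongr
            _ = _ := by ring
      _ = 8 * (P * D ^ 2) * M := by rw [← mul_sum, hMS]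
      _ ≤ 8 * M * M := by gcongr
      _ = _ := by ring
  simp_rw [sum_add_distrib]
  rw [h1]
  linarith

/-- The exponent budget: `P ≤ 4^y ≤ 2^(ηk/2)`, while `D²` is `2^(ηk/4)` up to a constant that a
further `2^(ηk/4)` absorbs for large `k`. Together they use exactly `2^(ηk)`. -/
theorem frequently_le_volume_dyadic_iUnion {ρ : ℕ → ℝ} (hρ : ∀ n, 0 ≤ ρ n)
    (hρ0 : Tendsto ρ atTop (𝓝 0)) {η : ℝ} (hη : 0 < η)
    (hfreq : ∃ᶠ k : ℕ in atTop,
      (2 : ℝ) ^ (η * k) ≤ ∑ n ∈ Ico (2 ^ k) (2 ^ (k + 1)), n.totient * ρ n) :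
    ∃ c : ℝ≥0∞, 0 < c ∧ ∃ᶠ k : ℕ in atTop, c ≤
      volume (⋃ n ∈ Ico (2 ^ k) (2 ^ (k + 1)), approxAddOrderOf UnitAddCircle n (ρ n)) := by
  set κ := 4 / η with hκ
  refine ⟨ENNReal.ofReal (3 / (8 * Real.exp (2 * κ) ^ 2 + 8)),
    ENNReal.ofReal_pos.2 (by positivity), ?_⟩
  obtain ⟨C, hC, hdiv⟩ := exists_card_divisors_le_rpow (δ := η / 8) (by positivity)
  have hsmall : ∀ᶠ n in atTop, 2 * ρ n ≤ 1 := by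
    filter_upwards [hρ0.eventually (ge_mem_nhds (show (0 : ℝ) < 1 / 2 by norm_num))] with n hn
    linarith
  obtain ⟨n₀, hn₀⟩ := eventually_atTop.1 hsmall
  have hlin : Tendsto (fun k : ℕ => η * k) atTop atTop :=
    tendsto_natCast_atTop_atTop.const_mul_atTop hη
  have hlarge : ∀ᶠ k : ℕ in atTop, C ^ 2 * 2 ^ (η / 4) ≤ (2 : ℝ) ^ (η / 4 * k) := by
    have h1 : Tendsto (fun k : ℕ => (2 : ℝ) ^ (η / 4 * k)) atTop atTop :=
      (tendsto_rpow_atTop_of_base_gt_one 2 one_lt_two).comp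
        (tendsto_natCast_atTop_atTop.const_mul_atTop (by positivity))
    exact h1.eventually_ge_atTop _
  refine (hfreq.and_eventually ((hlin.eventually_ge_atTop 4).and
    (hlarge.and (eventually_ge_atTop n₀)))).mono ?_
  rintro k ⟨hMk, hk4, hkC, hkn⟩
  set y := ⌊η * k / 4⌋₊ with hy
  have hy1 : 1 ≤ y := Nat.le_floor (by push_cast; linarith)
  have hyle : (y : ℝ) ≤ η * k / 4 := Nat.floor_le (by positivity)
  have hylt : η * k / 4 < y + 1 := Nat.lt_floor_add_one _
  refine le_volume_dyadic_iUnion (D := C * ((2 : ℝ) ^ (k + 1)) ^ (η / 8)) hy1 ?_ hρ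
    (fun n hn => ?_) (fun n hn => ?_) (lt_of_lt_of_le (by positivity) hMk) rfl ?_
  · calc (k : ℝ) = κ * (η * k / 4) := by rw [hκ]; field_simp
      _ ≤ κ * (y + 1) := by gcongr
  · refine hn₀ n (hkn.trans ?_)
    exact Nat.lt_two_pow_self.le.trans (mem_Ico.1 hn).1
  · have hn2 := mem_Ico.1 hn
    refine (hdiv n (lt_of_lt_of_le (by positivity) hn2.1)).trans ?_
    gcongr
    exact_mod_cast hn2.2.le
  · refine le_trans ?_ hMk
    have h1 : (primorial y : ℝ) ≤ 2 ^ (η * k / 2) := by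
      calc (primorial y : ℝ) ≤ 4 ^ y := by exact_mod_cast primorial_le_four_pow y
        _ = (2 : ℝ) ^ (2 * (y : ℝ)) := by
            rw [Real.rpow_mul two_pos.le, Real.rpow_natCast]
            norm_num
        _ ≤ _ := by
            apply Real.rpow_le_rpow_of_exponent_le one_le_two
            linarith
    have h2 : (((2 : ℝ) ^ (k + 1)) ^ (η / 8)) ^ 2 = 2 ^ (η / 4) * 2 ^ (η / 4 * k) := by
      rw [← Real.rpow_natCast, ← Real.rpow_natCast, ← Real.rpow_mul two_pos.le,
        ← Real.rpow_mul two_pos.le, ← Real.rpow_add two_pos]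
      congr 1
      push_cast
      ring
    calc (primorial y : ℝ) * (C * ((2 : ℝ) ^ (k + 1)) ^ (η / 8)) ^ 2
        ≤ 2 ^ (η * k / 2) * (C * ((2 : ℝ) ^ (k + 1)) ^ (η / 8)) ^ 2 := by gcongr
      _ = 2 ^ (η * k / 2) * (C ^ 2 * 2 ^ (η / 4)) * 2 ^ (η / 4 * k) := by rw [mul_pow, h2]; ring
      _ ≤ 2 ^ (η * k / 2) * 2 ^ (η / 4 * k) * 2 ^ (η / 4 * k) := by gcongr
      _ = 2 ^ (η * k) := by
          rw [← Real.rpow_add two_pos, ← Real.rpow_add two_pos]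
          congr 1
          ring

/-- Every tail union contains an entire good block, and measure is continuous along the decreasing
tails. -/
theorem le_volume_addWellApproximable {ρ : ℕ → ℝ} {c : ℝ≥0∞}
    (h : ∃ᶠ k : ℕ in atTop, c ≤
      volume (⋃ n ∈ Ico (2 ^ k) (2 ^ (k + 1)), approxAddOrderOf UnitAddCircle n (ρ n))) :
    c ≤ volume (addWellApproximable UnitAddCircle ρ) := by
  set V : ℕ → Set UnitAddCircle :=
    fun m => ⋃ n, ⋃ _ : 0 < n ∧ m ≤ n, approxAddOrderOf UnitAddCircle n (ρ n) with hV
  have hW : addWellApproximable UnitAddCircle ρ = ⋂ m, V m := by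
    rw [addWellApproximable, blimsup_eq_iInf_biSup_of_nat]
    simp [hV]
  have hanti : Antitone V := fun a b hab =>
    Set.iUnion_mono fun n => Set.iUnion_mono' fun hn => ⟨⟨hn.1, hab.trans hn.2⟩, subset_rfl⟩
  have hmeas : ∀ m, NullMeasurableSet (V m) := fun m =>
    (MeasurableSet.iUnion fun n => MeasurableSet.iUnion fun _ =>
      measurableSet_approxAddOrderOf n _).nullMeasurableSet
  rw [hW]
  refine ge_of_tendsto' (tendsto_measure_iInter_atTop hmeas hanti ⟨0, measure_ne_top _ _⟩)
    fun m => ?_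
  obtain ⟨k, hk, hkm⟩ := (h.and_eventually (eventually_ge_atTop m)).exists
  refine hk.trans (measure_mono (Set.iUnion₂_subset fun n hn => ?_))
  have hn := (mem_Ico.1 hn).1
  exact Set.subset_iUnion₂_of_subset n ⟨lt_of_lt_of_le (by positivity) hn,
    hkm.trans (Nat.lt_two_pow_self.le.trans hn)⟩ subset_rfl

/-! ### Truncation, and large dyadic sums from the divergence hypothesis. -/

/-- Truncating `ψ(n)` at `√n` and dividing by `n`. -/
noncomputable def truncatedRadius (ψ : ℕ → ℝ) (n : ℕ) : ℝ := min (ψ n) (√n) / n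

theorem truncatedRadius_nonneg {ψ : ℕ → ℝ} (hψ : ∀ n : ℕ, 1 ≤ n → 0 ≤ ψ n) (n : ℕ) :
    0 ≤ truncatedRadius ψ n := by
  rcases Nat.eq_zero_or_pos n with rfl | hn
  · simp [truncatedRadius]
  · exact div_nonneg (le_min (hψ n hn) (Real.sqrt_nonneg _)) (Nat.cast_nonneg _)

theorem tendsto_truncatedRadius {ψ : ℕ → ℝ} (hψ : ∀ n : ℕ, 1 ≤ n → 0 ≤ ψ n) :
    Tendsto (truncatedRadius ψ) atTop (𝓝 0) := by
  have h : Tendsto (fun n : ℕ => (√(n : ℝ))⁻¹) atTop (𝓝 0) :=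
    tendsto_inv_atTop_zero.comp (Real.tendsto_sqrt_atTop.comp tendsto_natCast_atTop_atTop)
  refine squeeze_zero (truncatedRadius_nonneg hψ) (fun n => ?_) h
  rw [truncatedRadius, ← Real.sqrt_div_self]
  gcongr
  exact min_le_right _ _

theorem addWellApproximable_truncatedRadius_subset (ψ : ℕ → ℝ) :
    addWellApproximable UnitAddCircle (truncatedRadius ψ) ⊆ W ψ := by
  intro x hx
  rw [UnitAddCircle.mem_addWellApproximable_iff] at hx
  simp only [W, Set.mem_iInter, Set.mem_iUnion]
  intro m hm
  obtain ⟨n, ⟨a, han, hcop, hxa⟩, hmn⟩ := hx.exists_gt m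
  have hn : 0 < n := by omega
  have hn' : (0 : ℝ) < n := by positivity
  obtain ⟨b, hb1, hbn, hbc, hbx⟩ : ∃ b : ℕ, 1 ≤ b ∧ b ≤ n ∧ b.Coprime n ∧
      ‖x - (((b : ℝ) / n : ℝ) : UnitAddCircle)‖ < truncatedRadius ψ n := by
    -- Numerators here run over `0 ≤ a < n`, those of `approxSet` over `1 ≤ a ≤ n`; they differ only
    -- at `n = 1`.
    rcases Nat.eq_zero_or_pos a with rfl | ha
    · have h1 : n = 1 := by simpa using hcop
      subst h1
      refine ⟨1, le_rfl, le_rfl, Nat.coprime_one_right 1, ?_⟩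
      have : (((1 : ℕ) : ℝ) / ((1 : ℕ) : ℝ) : ℝ) = (((0 : ℕ) : ℝ) / ((1 : ℕ) : ℝ) : ℝ) + 1 := by
        norm_num
      rw [this, AddCircle.coe_add_period]
      exact hxa
    · exact ⟨a, ha, han.le, hcop, hxa⟩
  refine ⟨n, hmn.le, ?_⟩
  simp only [approxSet, Set.mem_iUnion]
  refine ⟨b, ⟨hb1, hbn, hbc⟩, ?_⟩
  obtain ⟨z, rfl⟩ := QuotientAddGroup.mk_surjective x
  change ‖((z : ℝ) : UnitAddCircle) - _‖ < _ at hbx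
  rw [← AddCircle.coe_sub, UnitAddCircle.norm_eq] at hbx
  refine ⟨z - round (z - b / n), ?_, ?_⟩
  · have hle : truncatedRadius ψ n ≤ ψ n / n := by
      rw [truncatedRadius]
      gcongr
      exact min_le_left _ _
    have := abs_lt.1 (hbx.trans_le hle)
    rw [Set.mem_Ioo, sub_div, add_div]
    constructor <;> linarith [this.1, this.2]
  · change ((z - round (z - (b : ℝ) / n) : ℝ) : UnitAddCircle) = (z : UnitAddCircle)
    rw [AddCircle.coe_sub, sub_eq_self, AddCircle.coe_eq_zero_iff]
    exact ⟨round (z - (b : ℝ) / n), by simp⟩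

/-- If the truncated dyadic sums are small, the truncation is not effective for large `n`. -/
theorem eventually_lt_sqrt {ψ : ℕ → ℝ} (hψ : ∀ n : ℕ, 1 ≤ n → 0 ≤ ψ n) {η : ℝ} (hη1 : η ≤ 1 / 8)
    (h : ∀ᶠ k : ℕ in atTop,
      ∑ n ∈ Ico (2 ^ k) (2 ^ (k + 1)), n.totient * truncatedRadius ψ n < (2 : ℝ) ^ (η * k)) :
    ∀ᶠ n : ℕ in atTop, ψ n < √n := by
  obtain ⟨C, hC, hdiv⟩ := exists_card_divisors_le_rpow (δ := 1 / 8) (by norm_num)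
  have hlog : Tendsto (fun n : ℕ => Nat.log 2 n) atTop atTop :=
    tendsto_atTop.2 fun b => by
      filter_upwards [eventually_ge_atTop (2 ^ b)] with n hn
      exact Nat.le_log_of_pow_le one_lt_two hn
  have hbig : ∀ᶠ n : ℕ in atTop, C < (n : ℝ) ^ (1 / 4 : ℝ) :=
    ((tendsto_rpow_atTop (by norm_num)).comp
      tendsto_natCast_atTop_atTop).eventually_gt_atTop C
  filter_upwards [hlog.eventually h, hbig, eventually_gt_atTop 0] with n hn hCn hn0
  by_contra hcon
  push Not at hcon
  have hn' : (0 : ℝ) < n := by positivity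
  have hn1 : (1 : ℝ) ≤ n := by exact_mod_cast hn0
  set k := Nat.log 2 n
  have hmem : n ∈ Ico (2 ^ k) (2 ^ (k + 1)) :=
    mem_Ico.2 ⟨Nat.pow_log_le_self 2 hn0.ne', Nat.lt_pow_succ_log_self one_lt_two n⟩
  have h1 : n.totient * truncatedRadius ψ n < (2 : ℝ) ^ (η * k) :=
    lt_of_le_of_lt (single_le_sum (f := fun n : ℕ => n.totient * truncatedRadius ψ n)
      (fun i _ => mul_nonneg (Nat.cast_nonneg _) (truncatedRadius_nonneg hψ i)) hmem) hn
  have h2 : (2 : ℝ) ^ (η * k) ≤ (n : ℝ) ^ (1 / 8 : ℝ) := by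
    calc (2 : ℝ) ^ (η * k) ≤ (2 : ℝ) ^ ((k : ℝ) * (1 / 8)) := by
          apply Real.rpow_le_rpow_of_exponent_le one_le_two
          rw [mul_comm]
          gcongr
      _ = ((2 : ℝ) ^ k) ^ (1 / 8 : ℝ) := by
          rw [Real.rpow_mul two_pos.le, Real.rpow_natCast]
      _ ≤ _ := by
          gcongr
          exact_mod_cast (mem_Ico.1 hmem).1
  -- If `ψ n ≥ √n`, the single term `φ(n)/√n` is at least `n^(3/8)/C`, which exceeds `n^(1/8) ≥
  -- 2^(ηk)` once `n^(1/4) > C`.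
  have h3 : (n : ℝ) ≤ n.totient * (C * (n : ℝ) ^ (1 / 8 : ℝ)) := by
    calc (n : ℝ) ≤ n.totient * #n.divisors := by
          exact_mod_cast le_totient_mul_card_divisors hn0
      _ ≤ _ := by
          gcongr
          exact hdiv n hn0
  rw [truncatedRadius, min_eq_right hcon] at h1
  have h4 : (n.totient : ℝ) * √n < n * (n : ℝ) ^ (1 / 8 : ℝ) := by
    have := h1.trans_le h2
    rw [← mul_div_assoc, div_lt_iff₀ hn'] at this
    linarith
  have h5 : (n : ℝ) * √n < n * (C * (n : ℝ) ^ (1 / 4 : ℝ)) := by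
    calc (n : ℝ) * √n ≤ n.totient * (C * (n : ℝ) ^ (1 / 8 : ℝ)) * √n := by gcongr
      _ = (C * (n : ℝ) ^ (1 / 8 : ℝ)) * (n.totient * √n) := by ring
      _ < (C * (n : ℝ) ^ (1 / 8 : ℝ)) * (n * (n : ℝ) ^ (1 / 8 : ℝ)) := by gcongr
      _ = n * (C * ((n : ℝ) ^ (1 / 8 : ℝ) * (n : ℝ) ^ (1 / 8 : ℝ))) := by ring
      _ = _ := by
          rw [← Real.rpow_add hn']
          norm_num
  have h6 : √(n : ℝ) = (n : ℝ) ^ (1 / 4 : ℝ) * (n : ℝ) ^ (1 / 4 : ℝ) := by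
    rw [← Real.rpow_add hn', Real.sqrt_eq_rpow]
    norm_num
  rw [h6] at h5
  have h7 := lt_of_mul_lt_mul_left h5 hn'.le
  exact absurd (lt_of_mul_lt_mul_right h7 (by positivity)) (not_lt.2 hCn.le)

/-- Boundedness along `N = 2^k - 1` already contradicts divergence, so no sign condition on `f` is
required. -/
theorem not_tendsto_atTop_of_dyadic_le {f : ℕ → ℝ} {q : ℝ} (hq0 : 0 ≤ q) (hq1 : q < 1)
    (h : ∀ᶠ k : ℕ in atTop, ∑ n ∈ Ico (2 ^ k) (2 ^ (k + 1)), f n ≤ q ^ k) :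
    ¬ Tendsto (fun N : ℕ => ∑ n ∈ Icc 1 N, f n) atTop atTop := by
  intro ht
  obtain ⟨k₀, hk₀⟩ := eventually_atTop.1 h
  have hsub : Tendsto (fun k : ℕ => 2 ^ k - 1) atTop atTop :=
    tendsto_atTop_mono (fun k => Nat.le_sub_one_of_lt Nat.lt_two_pow_self) tendsto_id
  have hIcc : ∀ k : ℕ, Icc 1 (2 ^ k - 1) = Ico 1 (2 ^ k) := fun k => by
    ext n
    have : 0 < 2 ^ k := by positivity
    simp only [mem_Icc, mem_Ico]
    omega
  have ht2 : Tendsto (fun k : ℕ => ∑ n ∈ Ico 1 (2 ^ k), f n) atTop atTop := by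
    simpa [Function.comp_def, hIcc] using ht.comp hsub
  have hle : ∀ j : ℕ, ∑ n ∈ Ico 1 (2 ^ (k₀ + j)), f n ≤
      ∑ n ∈ Ico 1 (2 ^ k₀), f n + ∑ i ∈ range j, q ^ i := by
    intro j
    induction j with
    | zero => simp
    | succ j ih =>
      rw [← add_assoc, ← sum_Ico_consecutive f (Nat.one_le_two_pow (n := k₀ + j))
        (Nat.pow_le_pow_right two_pos (Nat.le_succ _)), sum_range_succ]
      have h1 := hk₀ (k₀ + j) (Nat.le_add_right _ _)
      have h2 : q ^ (k₀ + j) ≤ q ^ j := pow_le_pow_of_le_one hq0 hq1.le (Nat.le_add_left _ _)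
      linarith
  have hgeom : ∀ j : ℕ, ∑ i ∈ range j, q ^ i ≤ (1 - q)⁻¹ := fun j => by
    rw [← tsum_geometric_of_lt_one hq0 hq1]
    exact (summable_geometric_of_lt_one hq0 hq1).sum_le_tsum _ fun i _ => pow_nonneg hq0 i
  obtain ⟨k, hk, hkk⟩ := ((ht2.eventually_gt_atTop
    (∑ n ∈ Ico 1 (2 ^ k₀), f n + (1 - q)⁻¹)).and (eventually_ge_atTop k₀)).exists
  obtain ⟨j, rfl⟩ := Nat.exists_eq_add_of_le hkk
  linarith [hle j, hgeom j]

/-- Otherwise the truncation is eventually inactive and `ψ(n)/n ≤ n^(-1/2)`, so the factor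
`(ψ(n)/n)^ε` saves `2^(-εk/2)` on each block. As `η ≤ ε/4`, the block sums are at most `2^(-εk/4)`,
and the series could not diverge. The cap `1/8` on `η` serves `eventually_lt_sqrt`. -/
theorem exists_frequently_le_sum_truncatedRadius {ψ : ℕ → ℝ} (hψ : ∀ n : ℕ, 1 ≤ n → 0 ≤ ψ n)
    {ε : ℝ} (hε : 0 < ε)
    (hdiv : Tendsto
      (fun N : ℕ => ∑ n ∈ Icc 1 N, (ψ n / (n : ℝ)) ^ (1 + ε) * (Nat.totient n : ℝ)) atTop atTop) :
    ∃ η : ℝ, 0 < η ∧ ∃ᶠ k : ℕ in atTop, (2 : ℝ) ^ (η * k) ≤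
      ∑ n ∈ Ico (2 ^ k) (2 ^ (k + 1)), n.totient * truncatedRadius ψ n := by
  set η := min (ε / 4) (1 / 8) with hη
  have hη0 : 0 < η := lt_min (by positivity) (by norm_num)
  refine ⟨η, hη0, ?_⟩
  by_contra hcon
  simp only [not_frequently, not_le] at hcon
  obtain ⟨n₀, hn₀⟩ := eventually_atTop.1 (eventually_lt_sqrt hψ (min_le_right _ _) hcon)
  refine not_tendsto_atTop_of_dyadic_le (q := (2 : ℝ) ^ (-(ε / 4))) (by positivity)
    (Real.rpow_lt_one_of_one_lt_of_neg one_lt_two (by linarith)) ?_ hdiv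
  filter_upwards [hcon, eventually_ge_atTop n₀] with k hk hkn
  have hterm : ∀ n ∈ Ico (2 ^ k) (2 ^ (k + 1)),
      (ψ n / (n : ℝ)) ^ (1 + ε) * (n.totient : ℝ) ≤
        (2 : ℝ) ^ (-(ε / 2) * k) * (n.totient * truncatedRadius ψ n) := by
    intro n hn
    have hn2 := (mem_Ico.1 hn).1
    have hn0 : 0 < n := lt_of_lt_of_le (by positivity) hn2
    have hn' : (0 : ℝ) < n := by positivity
    have hlt := hn₀ n (hkn.trans (Nat.lt_two_pow_self.le.trans hn2))
    have hρ : truncatedRadius ψ n = ψ n / n := by rw [truncatedRadius, min_eq_left hlt.le]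
    have hρ0 : 0 ≤ ψ n / n := div_nonneg (hψ n hn0) hn'.le
    have hpow : (ψ n / n) ^ ε ≤ (2 : ℝ) ^ (-(ε / 2) * k) := by
      calc (ψ n / n) ^ ε ≤ ((n : ℝ) ^ (-(1 / 2) : ℝ)) ^ ε := by
            gcongr
            rw [div_le_iff₀ hn']
            refine hlt.le.trans (le_of_eq ?_)
            rw [← Real.rpow_add_one hn'.ne', Real.sqrt_eq_rpow]
            norm_num
        _ = (n : ℝ) ^ (-(ε / 2)) := by
            rw [← Real.rpow_mul hn'.le]
            congr 1
            ring
        _ ≤ ((2 : ℝ) ^ k) ^ (-(ε / 2)) := by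
            refine Real.rpow_le_rpow_of_nonpos (by positivity) ?_ (by linarith)
            exact_mod_cast hn2
        _ = _ := by
            rw [← Real.rpow_natCast, ← Real.rpow_mul two_pos.le, mul_comm]
    rw [hρ, Real.rpow_add' hρ0 (by linarith), Real.rpow_one]
    calc ψ n / n * (ψ n / n) ^ ε * n.totient
        ≤ ψ n / n * (2 : ℝ) ^ (-(ε / 2) * k) * n.totient := by gcongr
      _ = _ := by ring
  calc ∑ n ∈ Ico (2 ^ k) (2 ^ (k + 1)), (ψ n / (n : ℝ)) ^ (1 + ε) * (n.totient : ℝ)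
      ≤ (2 : ℝ) ^ (-(ε / 2) * k) *
          ∑ n ∈ Ico (2 ^ k) (2 ^ (k + 1)), n.totient * truncatedRadius ψ n := by
        rw [mul_sum]
        exact sum_le_sum hterm
    _ ≤ (2 : ℝ) ^ (-(ε / 2) * k) * (2 : ℝ) ^ (η * k) := by gcongr
    _ = (2 : ℝ) ^ ((-(ε / 2) + η) * k) := by
        rw [← Real.rpow_add two_pos, add_mul]
    _ ≤ (2 : ℝ) ^ (-(ε / 4) * k) := by
        apply Real.rpow_le_rpow_of_exponent_le one_le_two
        gcongr
        linarith [min_le_left (ε / 4) (1 / 8)]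
    _ = _ := by rw [Real.rpow_mul two_pos.le, Real.rpow_natCast]

end DuffinSchaeffer

theorem corollary1 (ψ : ℕ → ℝ) (hψ : ∀ n : ℕ, 1 ≤ n → 0 ≤ ψ n)
    (hdiv : ∃ ε : ℝ, 0 < ε ∧
      Filter.Tendsto
        (fun N : ℕ => ∑ n ∈ Finset.Icc 1 N, (ψ n / (n : ℝ)) ^ (1 + ε) * (Nat.totient n : ℝ))
        Filter.atTop Filter.atTop) :
    MeasureTheory.volume (DuffinSchaeffer.W ψ) = 1 := by
  obtain ⟨ε, hε, hdiv⟩ := hdiv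
  obtain ⟨η, hη, hfreq⟩ :=
    DuffinSchaeffer.exists_frequently_le_sum_truncatedRadius hψ hε hdiv
  have hρ0 := DuffinSchaeffer.tendsto_truncatedRadius hψ
  obtain ⟨c, hc, hvol⟩ := DuffinSchaeffer.frequently_le_volume_dyadic_iUnion
    (DuffinSchaeffer.truncatedRadius_nonneg hψ) hρ0 hη hfreq
  have hpos := hc.trans_le (DuffinSchaeffer.le_volume_addWellApproximable hvol)
  -- Gallagher's zero-one law, which is applied with radii tending to 0; the truncation ensures
  -- this.
  rcases AddCircle.addWellApproximable_ae_empty_or_univ (T := 1)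
    (DuffinSchaeffer.truncatedRadius ψ) hρ0 with hnot | hall
  · exact absurd (MeasureTheory.measure_eq_zero_iff_ae_notMem.2 hnot) hpos.ne'
  · rw [← UnitAddCircle.measure_univ]
    refine MeasureTheory.measure_congr (Filter.eventuallyEq_univ.2 ?_)
    exact hall.mono fun x hx => DuffinSchaeffer.addWellApproximable_truncatedRadius_subset ψ hx
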